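/- Let $\mathcal A$ be a unital $C^*$-algebra. Let $H_{\mathcal A}=\ell^2(\mathcal A)$ be the standard Hilbert $\mathcal A$-module: the sequences $x=(x_i)_{i\in\mathbb N}$ in $\mathcal A$ for which $\sum_i x_ix_i^*$ converges in norm, regarded as a left $\mathcal A$-module with inner product $\langle x,y\rangle=\sum_i y_ix_i^*$ and norm $\|x\|=\|\langle x,x\rangle\|^{1/2}$. (The convention with right modules is the same statement for the opposite algebra.) Let $B^a(H_{\mathcal A})$ be the algebra of bounded adjointable operators on $H_{\mathcal A}$ with the operator norm, and let $K(H_{\mathcal A})\subseteq B^a(H_{\mathcal A})$ be the compact operators, i.e. the closed linear span of the operators $\theta_{x,y}\colon z\mapsto\langle y,z\rangle x$, $x,y\in H_{\mathcal A}$. Isomorphisms of modules are bounded $\mathcal A$-linear bijections with bounded inverse. For $F\in B^a(H_{\mathcal A})$, a *decomposition* $$H_{\mathcal A}=M_1\tilde\oplus N_1\stackrel{F}{\longrightarrow}M_2\tilde\oplus N_2=H_{\mathcal A}$$ consists of closed submodules $M_1,N_1,M_2,N_2$ of $H_{\mathcal A}$ such that $H_{\mathcal A}$ is the direct (not necessarily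 orthogonal) sum of $M_1$ and $N_1$ and of $M_2$ and $N_2$, $F$ restricts to an isomorphism $F_1\colon M_1\to M_2$, and $F(N_1)\subseteq N_2$; that is, $F$ has the matrix $\begin{pmatrix}F_1&0\\0&F_4\end{pmatrix}$ with $F_1$ an isomorphism. For closed submodules write $N\preceq N'$ if $N$ is isomorphic to a closed submodule of $N'$. A submodule is finitely generated if it is the $\mathcal A$-linear span of a finite set. Let - $\mathcal M\Phi_+(H_{\mathcal A})$ (respectively $\mathcal M\Phi_-(H_{\mathcal A})$) be the set of $F\in B^a(H_{\mathcal A})$ that have a decomposition with $N_1$ (respectively $N_2$) finitely generated; - ${\mathcal M\Phi_+^-}'(H_{\mathcal A})$ be the set of $F\in\mathcal M\Phi_+(H_{\mathcal A})$ that have a decomposition with $N_1$ finitely generated and $N_1\preceq N_2$; - ${\mathcal M\Phi_-^+}'(H_{\mathcal A})$ be the set of $F\in\mathcal M\Phi_-(H_{\mathcal A})$ that have a decomposition with $N_2$ finitely generated and $N_2\preceq N_1$. **Lemma 5.9.** The sets ${\mathcal M\Phi_+^-}'(H_{\mathcal A})$ and ${\mathcal M\Phi_-^+}'(H_{\mathcal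 A})$ are open in $B^a(H_{\mathcal A})$ in the norm topology. Moreover, if $F\in{\mathcal M\Phi_+^-}'(H_{\mathcal A})$ and $K\in K(H_{\mathcal A})$, then $F+K\in{\mathcal M\Phi_+^-}'(H_{\mathcal A})$; and if $F\in{\mathcal M\Phi_-^+}'(H_{\mathcal A})$ and $K\in K(H_{\mathcal A})$, then $F+K\in{\mathcal M\Phi_-^+}'(H_{\mathcal A})$. -/

import Mathlib

namespace HilbertModule

open scoped InnerProductSpace

/-! ### Operators on a Hilbert C⋆-module -/

section Operators

variable (A E : Type*) [CStarAlgebra A] [PartialOrder A] [StarOrderedRing A]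
  [NormedAddCommGroup E] [NormedSpace ℂ E] [Module A E] [CStarModule A E]

/-- The algebra of bounded adjointable operators on the Hilbert `A`-module `E`, with the operator
norm. Adjointable operators are automatically `A`-linear, see `HilbertModule.adjointable_map_smul`
below. -/
def adjointable : Subalgebra ℂ (E →L[ℂ] E) where
  carrier := {T | ∃ S : E →L[ℂ] E, ∀ x y : E, ⟪T x, y⟫_A = ⟪x, S y⟫_A}
  mul_mem' := by
    rintro T₁ T₂ ⟨S₁, h₁⟩ ⟨S₂, h₂⟩
    exact ⟨S₂ * S₁, fun x y => by
      rw [mul_apply_eq_comp, mul_apply_eq_comp, h₁, h₂]⟩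
  add_mem' := by
    rintro T₁ T₂ ⟨S₁, h₁⟩ ⟨S₂, h₂⟩
    exact ⟨S₁ + S₂, fun x y => by
      rw [add_apply, add_apply,
        CStarModule.inner_add_left, CStarModule.inner_add_right, h₁, h₂]⟩
  algebraMap_mem' := fun c => ⟨algebraMap ℂ (E →L[ℂ] E) (star c), fun x y => by
    simp [Algebra.algebraMap_eq_smul_one]⟩

variable {A E}

theorem eq_of_inner_right {u v : E} (h : ∀ y : E, ⟪u, y⟫_A = ⟪v, y⟫_A) : u = v := by
  have h' : ⟪u - v, u - v⟫_A = 0 := by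
    rw [CStarModule.inner_sub_left, h, sub_self]
  exact sub_eq_zero.mp (CStarModule.inner_self.mp h')

theorem adjointable_map_smul (T : adjointable A E) (a : A) (x : E) :
    (T : E →L[ℂ] E) (a • x) = a • (T : E →L[ℂ] E) x := by
  obtain ⟨S, hS⟩ := T.2
  refine eq_of_inner_right (A := A) fun y => ?_
  rw [hS, CStarModule.inner_op_smul_left, CStarModule.inner_op_smul_left, hS]

theorem norm_smul_le_mul (a : A) (x : E) : ‖a • x‖ ≤ ‖a‖ * ‖x‖ := by
  refine abs_le_of_sq_le_sq' ?_ (by positivity) |>.2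
  rw [mul_pow, CStarModule.norm_sq_eq A (x := a • x), CStarModule.norm_sq_eq A (x := x),
    CStarModule.inner_op_smul_left, CStarModule.inner_op_smul_right]
  calc ‖a * ⟪x, x⟫_A * star a‖ ≤ ‖a * ⟪x, x⟫_A‖ * ‖star a‖ := norm_mul_le _ _
    _ ≤ (‖a‖ * ‖⟪x, x⟫_A‖) * ‖star a‖ := by gcongr; exact norm_mul_le _ _
    _ = ‖a‖ ^ 2 * ‖⟪x, x⟫_A‖ := by rw [norm_star]; ring

theorem smul_complex_smul (z : ℂ) (a : A) (x : E) : (z • a) • x = z • (a • x) := by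
  refine eq_of_inner_right (A := A) fun y => ?_
  simp

/-- The elementary operator `z ↦ ⟨y, z⟩ x`, as a bounded operator. -/
noncomputable def rankOneCLM (x y : E) : E →L[ℂ] E :=
  LinearMap.mkContinuous
    { toFun := fun z => ⟪y, z⟫_A • x
      map_add' := fun z w => by rw [CStarModule.inner_add_right, add_smul]
      map_smul' := fun c z => by
        rw [CStarModule.inner_smul_right_complex, smul_complex_smul, RingHom.id_apply] }
    (‖y‖ * ‖x‖) fun z => by
      refine (norm_smul_le_mul (A := A) _ x).trans ?_
      calc ‖⟪y, z⟫_A‖ * ‖x‖ ≤ (‖y‖ * ‖z‖) * ‖x‖ := by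
            gcongr; exact CStarModule.norm_inner_le E
        _ = ‖y‖ * ‖x‖ * ‖z‖ := by ring

/-- The elementary operator `θ_{x,y} : z ↦ ⟨y, z⟩ x`, as an adjointable operator. -/
noncomputable def rankOne (x y : E) : adjointable A E :=
  ⟨rankOneCLM (A := A) x y, rankOneCLM (A := A) y x, fun z w => by
    change ⟪⟪y, z⟫_A • x, w⟫_A = ⟪z, ⟪x, w⟫_A • y⟫_A
    simp⟩

variable (A E) in
/-- The compact operators on the Hilbert `A`-module `E`: the closed linear span of the elementary
operators `θ_{x,y}` inside the adjointable operators. -/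
noncomputable def compactOperators : Submodule ℂ (adjointable A E) :=
  (Submodule.span ℂ
    (Set.range fun p : E × E => (rankOne p.1 p.2 : adjointable A E))).topologicalClosure

/-- `N ⪯ N'`: the submodule `N` is isomorphic to a closed submodule of `N'`. Isomorphisms are
bounded `A`-linear bijections with bounded inverse. -/
def Preceq (N N' : Submodule A E) : Prop :=
  ∃ P : Submodule A E, P ≤ N' ∧ IsClosed (P : Set E) ∧ Nonempty (N ≃L[A] P)

/-- `E = M₁ ⊕ N₁ → M₂ ⊕ N₂ = E` is a pair of (not necessarily orthogonal) direct sum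
decompositions into closed submodules, with respect to which `F` has a diagonal matrix
`diag(F₁, F₄)` where `F₁ : M₁ → M₂` is an isomorphism. -/
structure IsDecomposition (F : adjointable A E) (M₁ N₁ M₂ N₂ : Submodule A E) : Prop where
  closed_M₁ : IsClosed (M₁ : Set E)
  closed_N₁ : IsClosed (N₁ : Set E)
  closed_M₂ : IsClosed (M₂ : Set E)
  closed_N₂ : IsClosed (N₂ : Set E)
  isCompl_domain : IsCompl M₁ N₁
  isCompl_codomain : IsCompl M₂ N₂
  /-- `F` maps `M₁` isomorphically onto `M₂`. -/
  iso : ∃ F₁ : M₁ ≃L[A] M₂, ∀ x : M₁, (F₁ x : E) = (F : E →L[ℂ] E) x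
  /-- `F` maps `N₁` into `N₂`. -/
  mapsTo : ∀ x ∈ N₁, (F : E →L[ℂ] E) x ∈ N₂

variable (A E)

/-- The upper semi-`A`-Fredholm operators `MΦ₊(E)`. -/
def upperSemiFredholm : Set (adjointable A E) :=
  {F | ∃ M₁ N₁ M₂ N₂ : Submodule A E, IsDecomposition F M₁ N₁ M₂ N₂ ∧ N₁.FG}

/-- The lower semi-`A`-Fredholm operators `MΦ₋(E)`. -/
def lowerSemiFredholm : Set (adjointable A E) :=
  {F | ∃ M₁ N₁ M₂ N₂ : Submodule A E, IsDecomposition F M₁ N₁ M₂ N₂ ∧ N₂.FG}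

/-- The class `MΦ₊⁻′(E)`. -/
def upperMinusPrime : Set (adjointable A E) :=
  {F | F ∈ upperSemiFredholm A E ∧ ∃ M₁ N₁ M₂ N₂ : Submodule A E,
    IsDecomposition F M₁ N₁ M₂ N₂ ∧ N₁.FG ∧ Preceq N₁ N₂}

/-- The class `MΦ₋⁺′(E)`. -/
def lowerPlusPrime : Set (adjointable A E) :=
  {F | F ∈ lowerSemiFredholm A E ∧ ∃ M₁ N₁ M₂ N₂ : Submodule A E,
    IsDecomposition F M₁ N₁ M₂ N₂ ∧ N₂.FG ∧ Preceq N₂ N₁}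

end Operators

/-! ### The standard module -/

section Standard

variable {A : Type*} [CStarAlgebra A] [PartialOrder A] [StarOrderedRing A]

theorem summable_of_nonneg_of_le {ι : Type*} {f g : ι → A} (hf : ∀ i, 0 ≤ f i)
    (hfg : ∀ i, f i ≤ g i) (hg : Summable g) : Summable f := by
  rw [summable_iff_vanishing_norm] at hg ⊢
  intro ε hε
  obtain ⟨s, hs⟩ := hg ε hε
  refine ⟨s, fun t ht => lt_of_le_of_lt ?_ (hs t ht)⟩
  exact CStarAlgebra.norm_le_norm_of_nonneg_of_le (Finset.sum_nonneg fun i _ => hf i)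
    (Finset.sum_le_sum fun i _ => hfg i)

variable (A) in
/-- The sequences `(aᵢ)` in `A` for which `∑ aᵢ aᵢ⋆` converges in norm. -/
def sqSummable : Submodule A (ℕ → A) where
  carrier := {f | Summable fun i => f i * star (f i)}
  zero_mem' := by simp
  add_mem' := by
    intro f g hf hg
    have hfg : Summable fun i => (2 : ℕ) • (f i * star (f i)) + (2 : ℕ) • (g i * star (g i)) := by
      simpa [two_smul] using (hf.add hf).add (hg.add hg)
    refine summable_of_nonneg_of_le (fun i => mul_star_self_nonneg _) (fun i => ?_) hfg
    rw [← sub_nonneg]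
    have h := mul_star_self_nonneg (f i - g i)
    convert h using 1
    simp only [Pi.add_apply, star_add, star_sub, two_smul]
    noncomm_ring
  smul_mem' := by
    intro a f hf
    have h := (Summable.mul_left a hf).mul_right (star a)
    refine h.congr fun i => ?_
    simp [mul_assoc]

variable (A) in
/-- The standard Hilbert `A`-module `H_A = ℓ²(A)`. This is a type synonym, because the topology of
`H_A` is not the product topology. -/
def StdModule : Type _ := sqSummable A

namespace StdModule

instance : AddCommGroup (StdModule A) := inferInstanceAs (AddCommGroup (sqSummable A))

instance : Module A (StdModule A) := inferInstanceAs (Module A (sqSummable A))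

noncomputable instance : Module ℂ (StdModule A) := inferInstanceAs (Module ℂ (sqSummable A))

/-- The `i`-th entry of an element of the standard module. -/
def coord (x : StdModule A) (i : ℕ) : A := x.1 i

theorem ext_coord {x y : StdModule A} (h : ∀ i, x.coord i = y.coord i) : x = y :=
  Subtype.ext (funext h)

theorem coord_add (x y : StdModule A) (i : ℕ) : (x + y).coord i = x.coord i + y.coord i := rfl

theorem coord_smul (a : A) (x : StdModule A) (i : ℕ) : (a • x).coord i = a * x.coord i := rfl

theorem coord_smul_complex (z : ℂ) (x : StdModule A) (i : ℕ) :
    (z • x).coord i = z • x.coord i := rfl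

theorem summable_self (x : StdModule A) : Summable fun i => x.coord i * star (x.coord i) := x.2

theorem summable_inner (x y : StdModule A) : Summable fun i => y.coord i * star (x.coord i) := by
  have h (c : ℂ) : Summable fun i => c • ((y + c • x).coord i * star ((y + c • x).coord i)) :=
    (summable_self (y + c • x)).const_smul c
  have hs := (((h 1).add (h (-1))).add ((h Complex.I).add (h (-Complex.I)))).const_smul (1 / 4 : ℂ)
  convert hs using 2 with i
  simp only [coord_add, coord_smul_complex, star_add, star_smul, add_mul, mul_add,
    smul_mul_assoc, mul_smul_comm, smul_add, smul_smul, RCLike.star_def, map_neg, map_one,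
    Complex.conj_I]
  ring_nf
  simp only [Complex.I_sq, Complex.I_pow_three]
  module

/-- The `A`-valued inner product `⟨x, y⟩ = ∑ yᵢ xᵢ⋆`. -/
noncomputable instance : Inner A (StdModule A) where
  inner x y := ∑' i, y.coord i * star (x.coord i)

theorem inner_def (x y : StdModule A) : ⟪x, y⟫_A = ∑' i, y.coord i * star (x.coord i) := rfl

/-- The norm `‖x‖ = ‖⟨x, x⟩‖ ^ (1/2)`. -/
noncomputable instance : Norm (StdModule A) := CStarModule.norm A

noncomputable instance : CStarModule A (StdModule A) where
  inner_add_right {x y z} := by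
    simp only [inner_def, coord_add, add_mul]
    exact (summable_inner x y).tsum_add (summable_inner x z)
  inner_self_nonneg := tsum_nonneg fun i => mul_star_self_nonneg _
  inner_self {x} := by
    refine ⟨fun h => ?_, fun h => by subst h; exact (tsum_congr fun i => zero_mul _).trans tsum_zero⟩
    have h0 : HasSum (fun i => x.coord i * star (x.coord i)) 0 := by
      rw [← h]; exact (summable_self x).hasSum
    have h1 := (hasSum_zero_iff_of_nonneg fun i => mul_star_self_nonneg (x.coord i)).mp h0
    exact ext_coord fun i => (CStarRing.mul_star_self_eq_zero_iff _).mp (congrFun h1 i)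
  inner_op_smul_right {a x y} := by
    simp only [inner_def, coord_smul, mul_assoc]
    exact (summable_inner x y).tsum_mul_left a
  inner_smul_right_complex {z x y} := by
    simp only [inner_def, coord_smul_complex, smul_mul_assoc]
    exact (summable_inner x y).tsum_const_smul z
  star_inner x y := by
    simp only [inner_def]
    rw [tsum_star]
    simp
  norm_eq_sqrt_norm_inner_self x := rfl

noncomputable instance : NormedAddCommGroup (StdModule A) :=
  NormedAddCommGroup.ofCore (CStarModule.normedSpaceCore A)

noncomputable instance : NormedSpace ℂ (StdModule A) :=
  NormedSpace.ofCore (CStarModule.normedSpaceCore A)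

end StdModule

end Standard

end HilbertModule

/-!
`MΦ₊⁻′` is the set of sums of a left invertible operator and a compact one, and `MΦ₋⁺′` is the set
of sums of a right invertible operator and a compact one. One-sided invertible operators form open
sets, and compact operators form a subspace, so both claims follow from these descriptions.

A decomposition of `F` is the same as an outer inverse: a bounded `A`-linear `B` with `B F B = B`,
for which `N₁ = ker (B F)` and `N₂ = ker B`. Given `N₁ ⪯ N₂` with `N₁` finitely generated, replacing
`F` on `N₁` by the embedding `N₁ → N₂` is a finite rank perturbation to a left invertible operator;
a finitely generated closed submodule is the range of a finite rank idempotent because its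
generators have an invertible frame operator. Conversely, if `F = D + C` with `J D = 1` and `C` of
finite rank, then, up to a small change of `D`, `F` agrees with `D` on the kernel of an idempotent
`T` with finitely generated range, and `(1 - T) J` is an outer inverse of `F`. The right invertible
case is symmetric.
-/

namespace HilbertModule

open scoped InnerProductSpace Pointwise NNReal
open Filter Topology

/-! ### Operators which are bounded below -/

section BoundedBelow

variable {𝕜 X : Type*} [NontriviallyNormedField 𝕜] [NormedAddCommGroup X] [NormedSpace 𝕜 X]

theorem norm_inv_le_of_antilipschitz {V : X →L[𝕜] X} {K : ℝ≥0} (hV : AntilipschitzWith K V)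
    {u : (X →L[𝕜] X)ˣ} (hu : K * ‖V - u‖ ≤ 1 / 2) : ‖(↑u⁻¹ : X →L[𝕜] X)‖ ≤ 2 * K := by
  refine ContinuousLinearMap.opNorm_le_bound _ (by positivity) fun z => ?_
  set w := (↑u⁻¹ : X →L[𝕜] X) z
  have hw : (u : X →L[𝕜] X) w = z := congr($u.mul_inv z)
  have hVw : ‖V w‖ ≤ ‖V - u‖ * ‖w‖ + ‖z‖ := by
    calc ‖V w‖ = ‖(V - u) w + z‖ := by rw [sub_apply, hw, sub_add_cancel]
      _ ≤ ‖V - u‖ * ‖w‖ + ‖z‖ := (norm_add_le _ _).trans (by gcongr; exact (V - u).le_opNorm w)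
  have hle : ‖w‖ ≤ 1 / 2 * ‖w‖ + K * ‖z‖ := by
    calc ‖w‖ ≤ K * ‖V w‖ := ZeroHomClass.bound_of_antilipschitz V hV w
      _ ≤ K * (‖V - u‖ * ‖w‖ + ‖z‖) := by gcongr
      _ = K * ‖V - u‖ * ‖w‖ + K * ‖z‖ := by ring
      _ ≤ 1 / 2 * ‖w‖ + K * ‖z‖ := by gcongr
  linarith

theorem isUnit_of_antilipschitz_of_mem_closure [CompleteSpace X] {V : X →L[𝕜] X} {K : ℝ≥0}
    (hV : AntilipschitzWith K V) (hcl : V ∈ closure {U | IsUnit U}) : IsUnit V := by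
  nontriviality X →L[𝕜] X
  obtain ⟨_, ⟨u, rfl⟩, hu⟩ := Metric.mem_closure_iff.mp hcl (1 / (2 * (K + 1))) (by positivity)
  rw [dist_eq_norm, lt_div_iff₀ (by positivity)] at hu
  have hinv := norm_inv_le_of_antilipschitz hV (u := u) (by nlinarith [norm_nonneg (V - u)])
  refine (u.ofNearby V ?_).isUnit
  rw [inv_eq_one_div, lt_div_iff₀ (norm_pos_iff.mpr u⁻¹.ne_zero)]
  nlinarith [norm_nonneg (V - u)]

theorem isUnit_of_isPreconnected_of_antilipschitz [CompleteSpace X] {ι : Type*}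
    [TopologicalSpace ι] {s : Set ι} (hs : IsPreconnected s) {φ : ι → X →L[𝕜] X}
    (hφ : Continuous φ) (hbelow : ∀ t ∈ s, ∃ K, AntilipschitzWith K (φ t))
    {t₀ t : ι} (ht₀ : t₀ ∈ s) (hunit : IsUnit (φ t₀)) (ht : t ∈ s) : IsUnit (φ t) := by
  have hopen : IsOpen (φ ⁻¹' {U | IsUnit U}) := Units.isOpen.preimage hφ
  refine hs.subset_of_closure_inter_subset hopen ⟨t₀, ht₀, hunit⟩ ?_ ht
  rintro r ⟨hr, hrs⟩
  obtain ⟨K, hK⟩ := hbelow r hrs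
  exact isUnit_of_antilipschitz_of_mem_closure hK (hφ.closure_preimage_subset _ hr)

end BoundedBelow

section RestrictScalars

variable (𝕜 : Type*) {R X : Type*} [NontriviallyNormedField 𝕜] [Ring R] [NormedAddCommGroup X]
  [NormedSpace 𝕜 X] [Module R X]

theorem isUnit_of_isUnit_restrictScalars [LinearMap.CompatibleSMul X X 𝕜 R] {V : X →L[R] X}
    (hV : IsUnit (V.restrictScalars 𝕜)) : IsUnit V := by
  obtain ⟨u, hu⟩ := hV
  set W : X →L[𝕜] X := ↑u⁻¹
  have hleft (x : X) : W (V x) = x := congr(W ($hu x)).symm.trans congr($u.inv_mul x)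
  have hright (x : X) : V (W x) = x := congr($hu (W x)).symm.trans congr($u.mul_inv x)
  have hsmul (a : R) (x : X) : W (a • x) = a • W x := by
    calc W (a • x) = W (V (a • W x)) := by rw [V.map_smul, hright]
      _ = a • W x := hleft _
  exact ⟨⟨V, { W with map_smul' := hsmul }, ContinuousLinearMap.ext hright,
    ContinuousLinearMap.ext hleft⟩, rfl⟩

theorem isTopCompl_of_isClosed [SMul 𝕜 R] [IsScalarTower 𝕜 R X] [CompleteSpace X]
    {M N : Submodule R X} (h : IsCompl M N) (hM : IsClosed (M : Set X))
    (hN : IsClosed (N : Set X)) : Submodule.IsTopCompl M N := by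
  have h' := (Submodule.isCompl_restrictScalars_iff 𝕜).mpr h
  exact ⟨h, (Submodule.IsCompl.isTopCompl_of_isClosed h' hM hN).continuous_projection⟩

end RestrictScalars

section Module

variable {A E : Type*} [CStarAlgebra A] [PartialOrder A] [StarOrderedRing A]
  [NormedAddCommGroup E] [NormedSpace ℂ E] [Module A E] [CStarModule A E]

theorem norm_le_norm_add_of_inner_nonneg {x y : E} (h : 0 ≤ ⟪x, y⟫_A) : ‖x‖ ≤ ‖x + y‖ := by
  have h' : 0 ≤ ⟪y, x⟫_A := by rw [← CStarModule.star_inner, star_nonneg_iff]; exact h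
  refine le_of_sq_le_sq ?_ (norm_nonneg _)
  rw [CStarModule.norm_sq_eq A, CStarModule.norm_sq_eq A]
  refine CStarAlgebra.norm_le_norm_of_nonneg_of_le CStarModule.inner_self_nonneg ?_
  calc ⟪x, x⟫_A ≤ ⟪x, x⟫_A + (⟪x, y⟫_A + ⟪y, x⟫_A + ⟪y, y⟫_A) :=
        le_add_of_nonneg_right (add_nonneg (add_nonneg h h') CStarModule.inner_self_nonneg)
    _ = ⟪x + y, x + y⟫_A := by
        simp only [CStarModule.inner_add_left, CStarModule.inner_add_right]; abel

theorem isUnit_of_inner_nonneg_of_antilipschitz [CompleteSpace E] {S : E →L[ℂ] E} {K : ℝ≥0}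
    (hpos : ∀ z, 0 ≤ ⟪z, S z⟫_A) (hS : AntilipschitzWith K S) : IsUnit S := by
  -- The method of continuity, along the segment from `1` to `S`.
  let φ : ℝ → E →L[ℂ] E := fun t => (1 - t) • 1 + t • S
  have hbelow : ∀ t ∈ Set.Icc (0 : ℝ) 1, ∃ K, AntilipschitzWith K (φ t) := by
    rintro t ⟨ht₀, ht₁⟩
    obtain rfl | ht₁ := ht₁.eq_or_lt
    · exact ⟨K, by simpa [φ] using hS⟩
    · refine ⟨(1 - t)⁻¹.toNNReal, (φ t).antilipschitz_of_bound fun z => ?_⟩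
      have hz : 0 ≤ ⟪(1 - t) • z, t • S z⟫_A := by
        rw [CStarModule.inner_smul_left_real, CStarModule.inner_smul_right_real]
        exact smul_nonneg (sub_nonneg.mpr ht₁.le) (smul_nonneg ht₀ (hpos z))
      have ht : 0 < 1 - t := sub_pos.mpr ht₁
      rw [Real.coe_toNNReal _ (inv_nonneg.mpr ht.le), ← div_eq_inv_mul, le_div_iff₀' ht]
      calc (1 - t) * ‖z‖ = ‖(1 - t) • z‖ := by
            rw [norm_smul, Real.norm_of_nonneg ht.le]
        _ ≤ ‖φ t z‖ := norm_le_norm_add_of_inner_nonneg hz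
  simpa [φ] using isUnit_of_isPreconnected_of_antilipschitz isPreconnected_Icc
    (by fun_prop : Continuous φ) hbelow (Set.left_mem_Icc.mpr zero_le_one) (by simp [φ])
    (Set.right_mem_Icc.mpr zero_le_one)

/-! ### Finite rank operators and frames -/

/-- The bounded `A`-linear map underlying an adjointable operator. -/
def toCLM : adjointable A E →+* (E →L[A] E) where
  toFun T := { (T : E →L[ℂ] E) with map_smul' := adjointable_map_smul T }
  map_one' := rfl
  map_mul' _ _ := rfl
  map_zero' := rfl
  map_add' _ _ := rfl

theorem toCLM_apply (T : adjointable A E) (x : E) : toCLM T x = T.1 x := rfl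

instance : IsScalarTower ℂ A E := ⟨smul_complex_smul⟩

instance (N : Submodule A E) : CStarModule A N where
  inner x y := ⟪(x : E), (y : E)⟫_A
  inner_add_right := CStarModule.inner_add_right
  inner_self_nonneg := CStarModule.inner_self_nonneg
  inner_self := by simp [CStarModule.inner_self]
  inner_op_smul_right := CStarModule.inner_op_smul_right
  inner_smul_right_complex := CStarModule.inner_smul_right_complex
  star_inner x y := CStarModule.star_inner (x : E) y
  norm_eq_sqrt_norm_inner_self x := CStarModule.norm_eq_sqrt_norm_inner_self (x : E)

theorem rankOne_apply (x y z : E) :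
    (rankOne x y : adjointable A E).1 z = ⟪y, z⟫_A • x := rfl

theorem mul_rankOne (T : adjointable A E) (x y : E) : T * rankOne x y = rankOne (T.1 x) y :=
  Subtype.ext <| ContinuousLinearMap.ext fun _ => adjointable_map_smul T _ _

theorem rankOne_mul {T : adjointable A E} {S : E → E}
    (hS : ∀ x y : E, ⟪T.1 x, y⟫_A = ⟪x, S y⟫_A) (x y : E) :
    rankOne x y * T = rankOne x (S y) := by
  refine Subtype.ext <| ContinuousLinearMap.ext fun z => ?_
  change ⟪y, T.1 z⟫_A • x = ⟪S y, z⟫_A • x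
  rw [← CStarModule.star_inner (T.1 z), hS, CStarModule.star_inner]

theorem norm_rankOne_le (x y : E) : ‖(rankOne x y : adjointable A E)‖ ≤ ‖y‖ * ‖x‖ :=
  ContinuousLinearMap.opNorm_le_bound _ (by positivity) fun z => by
    calc ‖⟪y, z⟫_A • x‖ ≤ ‖⟪y, z⟫_A‖ * ‖x‖ := norm_smul_le_mul _ x
      _ ≤ ‖y‖ * ‖z‖ * ‖x‖ := by gcongr; exact CStarModule.norm_inner_le E
      _ = ‖y‖ * ‖x‖ * ‖z‖ := mul_right_comm _ _ _

variable (A E) in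
/-- The linear span of the elementary operators `θ_{x,y}`, whose closure is `compactOperators`. -/
noncomputable def finiteRank : Submodule ℂ (adjointable A E) :=
  Submodule.span ℂ (Set.range fun p : E × E => (rankOne p.1 p.2 : adjointable A E))

theorem rankOne_mem_finiteRank (x y : E) : rankOne x y ∈ finiteRank A E :=
  Submodule.subset_span ⟨(x, y), rfl⟩

theorem mul_mem_finiteRank (T : adjointable A E) {C : adjointable A E} (hC : C ∈ finiteRank A E) :
    T * C ∈ finiteRank A E := by
  suffices h : finiteRank A E ≤ (finiteRank A E).comap (LinearMap.mulLeft ℂ T) from h hC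
  refine Submodule.span_le.mpr ?_
  rintro _ ⟨⟨x, y⟩, rfl⟩
  change T * rankOne x y ∈ finiteRank A E
  rw [mul_rankOne]
  exact rankOne_mem_finiteRank _ _

theorem finiteRank_mul_mem (T : adjointable A E) {C : adjointable A E} (hC : C ∈ finiteRank A E) :
    C * T ∈ finiteRank A E := by
  obtain ⟨S, hS⟩ := T.2
  suffices h : finiteRank A E ≤ (finiteRank A E).comap (LinearMap.mulRight ℂ T) from h hC
  refine Submodule.span_le.mpr ?_
  rintro _ ⟨⟨x, y⟩, rfl⟩
  change rankOne x y * T ∈ finiteRank A E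
  rw [rankOne_mul hS]
  exact rankOne_mem_finiteRank _ _

section Frame

variable {ι : Type*}

variable (A) in
/-- The frame operator `∑_{i ∈ s} θ_{xᵢ,xᵢ}` of a finite subfamily of `x`. -/
noncomputable def frameOperator (s : Finset ι) (x : ι → E) : adjointable A E :=
  ∑ i ∈ s, rankOne (x i) (x i)

theorem frameOperator_apply (s : Finset ι) (x : ι → E) (z : E) :
    (frameOperator A s x).1 z = ∑ i ∈ s, ⟪x i, z⟫_A • x i := by
  simp [frameOperator, rankOne_apply]

theorem inner_frameOperator_left (s : Finset ι) (x : ι → E) (z w : E) :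
    ⟪(frameOperator A s x).1 z, w⟫_A = ⟪z, (frameOperator A s x).1 w⟫_A := by
  simp [frameOperator_apply, CStarModule.inner_sum_left, CStarModule.inner_sum_right]

theorem inner_frameOperator_self (s : Finset ι) (x : ι → E) (z : E) :
    ⟪z, (frameOperator A s x).1 z⟫_A = ∑ i ∈ s, ⟪x i, z⟫_A * star ⟪x i, z⟫_A := by
  simp [frameOperator_apply, CStarModule.inner_sum_right]

theorem norm_sq_inner_le_frameOperator {s : Finset ι} {i : ι} (hi : i ∈ s) (x : ι → E) (z : E) :
    ‖⟪x i, z⟫_A‖ ^ 2 ≤ ‖z‖ * ‖(frameOperator A s x).1 z‖ := by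
  calc ‖⟪x i, z⟫_A‖ ^ 2 = ‖⟪x i, z⟫_A * star ⟪x i, z⟫_A‖ := by
        rw [sq, CStarRing.norm_self_mul_star]
    _ ≤ ‖∑ j ∈ s, ⟪x j, z⟫_A * star ⟪x j, z⟫_A‖ :=
        CStarAlgebra.norm_le_norm_of_nonneg_of_le (mul_star_self_nonneg _)
          (Finset.single_le_sum (f := fun j => ⟪x j, z⟫_A * star ⟪x j, z⟫_A)
            (fun j _ => mul_star_self_nonneg _) hi)
    _ ≤ ‖z‖ * ‖(frameOperator A s x).1 z‖ := by
        rw [← inner_frameOperator_self]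
        exact CStarModule.norm_inner_le E

theorem exists_norm_coefficient_le [CompleteSpace E] [Fintype ι] {x : ι → E}
    (hx : Submodule.span A (Set.range x) = ⊤) :
    ∃ C : ℝ≥0, ∀ z, ∃ a : ι → A, (∀ i, ‖a i‖ ≤ C * ‖z‖) ∧ ∑ i, a i • x i = z := by
  let T : (ι → A) →L[ℂ] E :=
    ((Fintype.linearCombination A x).restrictScalars ℂ).mkContinuous (∑ i, ‖x i‖) fun a => by
      rw [LinearMap.restrictScalars_apply, Fintype.linearCombination_apply, Finset.sum_mul]
      refine norm_sum_le_of_le _ fun i _ => (norm_smul_le_mul _ _).trans ?_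
      rw [mul_comm]
      gcongr
      exact norm_le_pi_norm a i
  have hsurj : Function.Surjective T := by
    rw [← Fintype.range_linearCombination, LinearMap.range_eq_top] at hx
    exact hx
  obtain ⟨C, hC, hpre⟩ := T.exists_preimage_norm_le hsurj
  refine ⟨⟨C, hC.le⟩, fun z => ?_⟩
  obtain ⟨a, ha, hle⟩ := hpre z
  exact ⟨a, fun i => (norm_le_pi_norm a i).trans hle, ha⟩

theorem exists_antilipschitz_frameOperator [CompleteSpace E] [Fintype ι] {x : ι → E}
    (hx : Submodule.span A (Set.range x) = ⊤) :
    ∃ K, AntilipschitzWith K (frameOperator A Finset.univ x).1 := by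
  obtain ⟨C, hC⟩ := exists_norm_coefficient_le hx
  refine ⟨(Fintype.card ι * C) ^ 2, ContinuousLinearMap.antilipschitz_of_bound _ fun z => ?_⟩
  set S := (frameOperator A Finset.univ x).1
  obtain ⟨a, ha, haz⟩ := hC z
  have hcoeff (i : ι) : ‖⟪x i, z⟫_A‖ ≤ √(‖z‖ * ‖S z‖) :=
    Real.le_sqrt_of_sq_le (norm_sq_inner_le_frameOperator (Finset.mem_univ i) x z)
  have hexpand : ⟪z, z⟫_A = ∑ i, ⟪x i, z⟫_A * star (a i) := by
    conv_lhs => rw [← haz, CStarModule.inner_sum_left]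
    simp only [CStarModule.inner_op_smul_left, haz]
  have hle : ‖z‖ * ‖z‖ ≤ Fintype.card ι * C * √(‖z‖ * ‖S z‖) * ‖z‖ := by
    calc ‖z‖ * ‖z‖ = ‖∑ i, ⟪x i, z⟫_A * star (a i)‖ := by
          rw [← hexpand, ← sq, CStarModule.norm_sq_eq A]
      _ ≤ ∑ _i : ι, √(‖z‖ * ‖S z‖) * (C * ‖z‖) :=
          norm_sum_le_of_le _ fun i _ => (norm_mul_le _ _).trans <| by
            rw [norm_star]
            gcongr
            exacts [hcoeff i, ha i]
      _ = Fintype.card ι * C * √(‖z‖ * ‖S z‖) * ‖z‖ := by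
          rw [Finset.sum_const, Finset.card_univ, nsmul_eq_mul]; ring
  rcases (norm_nonneg z).eq_or_lt with hz | hz
  · rw [← hz]; positivity
  · have hroot := le_of_mul_le_mul_right hle hz
    refine le_of_mul_le_mul_right ?_ hz
    calc ‖z‖ * ‖z‖ ≤ (Fintype.card ι * C * √(‖z‖ * ‖S z‖)) ^ 2 := by
          rw [← sq]; gcongr
      _ = (Fintype.card ι * C) ^ 2 * ‖S z‖ * ‖z‖ := by
          rw [mul_pow, Real.sq_sqrt (by positivity)]; ring
      _ = _ := by push_cast; rfl

theorem exists_dual_frame [CompleteSpace E] [Fintype ι] {x : ι → E}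
    (hx : Submodule.span A (Set.range x) = ⊤) :
    ∃ y : ι → E, ∀ z, ∑ i, ⟪x i, z⟫_A • y i = z := by
  obtain ⟨K, hK⟩ := exists_antilipschitz_frameOperator hx
  have hunit : IsUnit (frameOperator A Finset.univ x).1 := by
    refine isUnit_of_inner_nonneg_of_antilipschitz (A := A) (fun z => ?_) hK
    rw [inner_frameOperator_self]
    exact Finset.sum_nonneg fun i _ => mul_star_self_nonneg _
  let S : E ≃ₗ[A] E := LinearEquiv.ofBijective (toCLM (frameOperator A Finset.univ x)).toLinearMap
    (ContinuousLinearMap.isUnit_iff_bijective.mp hunit)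
  refine ⟨fun i => S.symm (x i), fun z => ?_⟩
  simp only [← map_smul, ← map_sum]
  exact S.symm_apply_eq.mpr (frameOperator_apply _ _ _).symm

end Frame

theorem exists_finiteRank_extension [CompleteSpace E] {N : Submodule A E}
    (hN : IsClosed (N : Set E)) (hfg : N.FG) (f : N →ₗ[A] E) :
    ∃ C ∈ finiteRank A E, (∀ z : N, toCLM C z = f z) ∧ ∀ z, toCLM C z ∈ f.range := by
  have : CompleteSpace N := hN.completeSpace_coe
  have : Module.Finite A N := Module.Finite.iff_fg.mpr hfg
  obtain ⟨n, x, hx⟩ := Module.Finite.exists_fin (R := A) (M := N)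
  obtain ⟨y, hy⟩ := exists_dual_frame hx
  have happly (z : E) : toCLM (∑ i, rankOne (f (y i)) (x i : E) : adjointable A E) z =
      f (∑ i, ⟪(x i : E), z⟫_A • y i) := by
    simp [toCLM_apply, rankOne_apply]
  refine ⟨∑ i, rankOne (f (y i)) (x i : E), sum_mem fun i _ => rankOne_mem_finiteRank (A := A) _ _,
    fun z => ?_, fun z => ?_⟩
  · rw [happly]
    exact congrArg f (hy z)
  · rw [happly]
    exact f.mem_range_self _

theorem Preceq.exists_factorization [CompleteSpace E] {N N' : Submodule A E}
    (h : Preceq N N') (hN : IsClosed (N : Set E)) (hfg : N.FG) :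
    ∃ q ∈ finiteRank A E, ∃ i ∈ finiteRank A E, ∃ l ∈ finiteRank A E,
      LinearMap.IsProj N (toCLM q) ∧ (∀ z, toCLM i z ∈ N') ∧ l * i = q ∧ q * l = l := by
  obtain ⟨P, hPN', hP, ⟨e⟩⟩ := h
  have : Module.Finite A N := Module.Finite.iff_fg.mpr hfg
  have hPfg : P.FG := Module.Finite.iff_fg.mp (Module.Finite.equiv e.toLinearEquiv)
  obtain ⟨q, hq, hq_apply, hq_mem⟩ := exists_finiteRank_extension hN hfg N.subtype
  obtain ⟨i, -, hi_apply, hi_mem⟩ :=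
    exists_finiteRank_extension hN hfg (P.subtype ∘ₗ e.toLinearEquiv.toLinearMap)
  obtain ⟨l, hl, hl_apply, hl_mem⟩ :=
    exists_finiteRank_extension hP hPfg (N.subtype ∘ₗ e.symm.toLinearEquiv.toLinearMap)
  have hqN (z : E) : toCLM q z ∈ N := N.range_subtype ▸ hq_mem z
  have hlN (z : E) : toCLM l z ∈ N := by
    obtain ⟨w, hw⟩ := hl_mem z
    exact hw ▸ (e.symm w).2
  have hli (n : N) : toCLM l (toCLM i n) = n := by
    rw [hi_apply]
    exact (hl_apply (e n)).trans congr($(e.symm_apply_apply n))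
  refine ⟨q, hq, i * q, mul_mem_finiteRank i hq, l, hl, ⟨hqN, fun z hz => hq_apply ⟨z, hz⟩⟩,
    fun z => ?_, ?_, ?_⟩
  · obtain ⟨w, hw⟩ := hi_mem (toCLM q z)
    exact hPN' (hw ▸ (e w).2 : toCLM i (toCLM q z) ∈ P)
  · exact Subtype.ext <| ContinuousLinearMap.ext fun z => hli ⟨_, hqN z⟩
  · exact Subtype.ext <| ContinuousLinearMap.ext fun z => hq_apply ⟨_, hlN z⟩

/-! ### Decompositions and outer inverses -/

theorem preceq_of_hasLeftInverse {A E : Type*} [CStarAlgebra A] [NormedAddCommGroup E] [Module A E]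
    {N N' : Submodule A E} {f : N →L[A] E} (hf : f.HasLeftInverse) (hmem : ∀ z, f z ∈ N') :
    Preceq N N' := by
  refine ⟨f.range, ?_, hf.isClosed_range, ⟨ContinuousLinearEquiv.equivOfInverse
    f.rangeRestrict (hf.leftInverse.comp f.range.subtypeL) hf.leftInverse_leftInverse ?_⟩⟩
  · rintro _ ⟨z, rfl⟩
    exact hmem z
  · rintro ⟨_, z, rfl⟩
    exact Subtype.ext congr(f $(hf.leftInverse_leftInverse z))

theorem isDecomposition_of_outer_inverse {F : adjointable A E} {B : E →L[A] E}
    (hB : B * toCLM F * B = B) :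
    IsDecomposition F (B * toCLM F).range (B * toCLM F).ker (toCLM F * B).range B.ker := by
  have hBF : IsIdempotentElem (B * toCLM F) := by rw [IsIdempotentElem, ← mul_assoc, hB]
  have hFB : IsIdempotentElem (toCLM F * B) := by
    rw [IsIdempotentElem, mul_assoc, ← mul_assoc B, hB]
  have hker : (toCLM F * B).ker = B.ker := by
    refine le_antisymm (fun x hx => ?_) (LinearMap.ker_le_ker_comp _ _)
    exact congr($hB x).symm.trans ((congrArg B hx).trans (map_zero B))
  have hdom := ContinuousLinearMap.IsIdempotentElem.isTopCompl hBF
  have hcod := hker ▸ ContinuousLinearMap.IsIdempotentElem.isTopCompl hFB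
  have hleft (x : (B * toCLM F).range) : B (toCLM F x) = x :=
    (LinearMap.IsIdempotentElem.mem_range_iff
      (ContinuousLinearMap.IsIdempotentElem.toLinearMap hBF)).mp x.2
  have hright (x : (toCLM F * B).range) : toCLM F (B x) = x :=
    (LinearMap.IsIdempotentElem.mem_range_iff
      (ContinuousLinearMap.IsIdempotentElem.toLinearMap hFB)).mp x.2
  refine ⟨hdom.isClosed, hdom.isClosed', hcod.isClosed, hcod.isClosed', hdom.isCompl, hcod.isCompl,
    ⟨ContinuousLinearEquiv.equivOfInverse
      (((toCLM F).comp (Submodule.subtypeL _)).codRestrict _ fun x => ⟨toCLM F x, ?_⟩)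
      ((B.comp (Submodule.subtypeL _)).codRestrict _ fun x => ⟨B x, ?_⟩)
      (fun x => Subtype.ext (hleft x)) (fun x => Subtype.ext (hright x)), fun x => rfl⟩,
    fun x hx => hx⟩
  · exact congrArg (toCLM F) (hleft x)
  · exact congrArg B (hright x)

theorem IsDecomposition.exists_outer_inverse [CompleteSpace E] {F : adjointable A E}
    {M₁ N₁ M₂ N₂ : Submodule A E} (h : IsDecomposition F M₁ N₁ M₂ N₂) :
    ∃ B : E →L[A] E, B * toCLM F * B = B ∧ N₁ = (B * toCLM F).ker ∧ N₂ = B.ker := by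
  obtain ⟨F₁, hF₁⟩ := h.iso
  have hcod := isTopCompl_of_isClosed ℂ h.isCompl_codomain h.closed_M₂ h.closed_N₂
  let B : E →L[A] E := (M₁.subtypeL.comp F₁.symm.toContinuousLinearMap).comp
    (M₂.projectionOntoL N₂ hcod)
  have hker (x : E) : B x = 0 ↔ x ∈ N₂ := by
    simp [B]
  have hBF (x : M₁) : B (toCLM F x) = x := by
    simp [B, toCLM_apply, ← hF₁]
  have hBF_zero (x : E) (hx : x ∈ N₁) : B (toCLM F x) = 0 := (hker _).mpr (h.mapsTo x hx)
  refine ⟨B, ContinuousLinearMap.ext fun x => hBF _, le_antisymm hBF_zero fun x hx => ?_,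
    Submodule.ext fun x => (hker x).symm⟩
  obtain ⟨m, hm, n, hn, rfl⟩ := Submodule.mem_sup.mp
    (h.isCompl_domain.sup_eq_top ▸ Submodule.mem_top : x ∈ M₁ ⊔ N₁)
  have hm0 : m = 0 := by
    calc m = B (toCLM F (m + n)) := by
          rw [map_add, map_add, hBF_zero n hn, add_zero, hBF ⟨m, hm⟩]
      _ = 0 := hx
  rwa [hm0, zero_add]

/-! ### One-sided invertible operators and their finite rank perturbations -/

variable (A E) in
/-- The adjointable operators with a bounded `A`-linear left inverse. The inverse is not required to
be adjointable, because the decompositions of `IsDecomposition` need not be orthogonal. -/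
def leftInvertible : Set (adjointable A E) := {D | (toCLM D).HasLeftInverse}

variable (A E) in
/-- The adjointable operators with a bounded `A`-linear, not necessarily adjointable, right
inverse. -/
def rightInvertible : Set (adjointable A E) := {D | (toCLM D).HasRightInverse}

theorem mem_leftInvertible_iff {D : adjointable A E} :
    D ∈ leftInvertible A E ↔ ∃ J, J * toCLM D = 1 :=
  exists_congr fun _ => ⟨fun h => ContinuousLinearMap.ext h, fun h x => congr($h x)⟩

theorem mem_rightInvertible_iff {D : adjointable A E} :
    D ∈ rightInvertible A E ↔ ∃ R, toCLM D * R = 1 :=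
  exists_congr fun _ => ⟨fun h => ContinuousLinearMap.ext h, fun h x => congr($h x)⟩

theorem isOpen_leftInvertible [CompleteSpace E] : IsOpen (leftInvertible A E) := by
  refine isOpen_iff_mem_nhds.mpr fun D hD => ?_
  obtain ⟨J, hJ⟩ := mem_leftInvertible_iff.mp hD
  let φ (T : adjointable A E) : E →L[ℂ] E := J.restrictScalars ℂ * T.1
  have hφ : Continuous φ := continuous_const.mul continuous_subtype_val
  have hunit : IsUnit (φ D) :=
    (ContinuousLinearMap.ext fun x => congr($hJ x) : φ D = 1) ▸ isUnit_one
  filter_upwards [(Units.isOpen.preimage hφ).mem_nhds hunit] with T hT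
  obtain ⟨u, hu⟩ := isUnit_of_isUnit_restrictScalars ℂ (V := J * toCLM T) hT
  exact mem_leftInvertible_iff.mpr ⟨↑u⁻¹ * J, by rw [mul_assoc, ← hu, u.inv_mul]⟩

theorem isOpen_rightInvertible [CompleteSpace E] : IsOpen (rightInvertible A E) := by
  refine isOpen_iff_mem_nhds.mpr fun D hD => ?_
  obtain ⟨R, hR⟩ := mem_rightInvertible_iff.mp hD
  let φ (T : adjointable A E) : E →L[ℂ] E := T.1 * R.restrictScalars ℂ
  have hφ : Continuous φ := continuous_subtype_val.mul continuous_const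
  have hunit : IsUnit (φ D) :=
    (ContinuousLinearMap.ext fun x => congr($hR x) : φ D = 1) ▸ isUnit_one
  filter_upwards [(Units.isOpen.preimage hφ).mem_nhds hunit] with T hT
  obtain ⟨u, hu⟩ := isUnit_of_isUnit_restrictScalars ℂ (V := toCLM T * R) hT
  exact mem_rightInvertible_iff.mpr ⟨R * ↑u⁻¹, by rw [← mul_assoc, ← hu, u.mul_inv]⟩

section Ring

variable {R : Type*} [Ring R] {b f i l q : R}

theorem exists_left_inverse_add (hbf : b * f = 1 - q) (hbi : b * i = 0) (hfq : f * q = 0)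
    (hli : l * i = q) : ∃ c, c * (f + i) = 1 := by
  refine ⟨b + l * (1 - f * b), ?_⟩
  calc (b + l * (1 - f * b)) * (f + i)
      = b * f + l * f - l * f * (b * f) + l * i + (1 - l * f) * (b * i) := by noncomm_ring
    _ = 1 + l * (f * q) := by rw [hbf, hbi, hli]; noncomm_ring
    _ = 1 := by rw [hfq, mul_zero, add_zero]

theorem exists_right_inverse_add (hfb : f * b = 1 - q) (hfi : f * i = 0) (hli : l * i = q)
    (hql : q * l = l) : ∃ c, (f + l) * c = 1 := by
  refine ⟨b + i * (1 - l * b), ?_⟩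
  calc (f + l) * (b + i * (1 - l * b))
      = f * b + l * b + (f * i + l * i) * (1 - l * b) := by noncomm_ring
    _ = 1 + (l - q * l) * b := by rw [hfb, hfi, hli]; noncomm_ring
    _ = 1 := by rw [hql, sub_self, zero_mul, add_zero]

end Ring

theorem one_sub_mul_eq_one_sub_of_isProj {R X : Type*} [Ring R] [NormedAddCommGroup X] [Module R X]
    {N : Submodule R X} {p q : X →L[R] X} (hq : LinearMap.IsProj N q) (hp : ∀ x, x - p x ∈ N) :
    (1 - q) * p = 1 - q := by
  refine ContinuousLinearMap.ext fun x => ?_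
  change p x - q (p x) = x - q x
  rw [eq_comm, sub_eq_sub_iff_sub_eq_sub, ← map_sub, hq.map_id _ (hp x)]

theorem upperMinusPrime_subset [CompleteSpace E] :
    upperMinusPrime A E ⊆ leftInvertible A E + (finiteRank A E : Set (adjointable A E)) := by
  rintro F ⟨-, M₁, N₁, M₂, N₂, hdec, hfg, hprec⟩
  obtain ⟨q, hq, i, hi, l, -, hproj, hiN, hli, -⟩ :=
    hprec.exists_factorization hdec.closed_N₁ hfg
  obtain ⟨B, hB, rfl, rfl⟩ := hdec.exists_outer_inverse
  have hqq : toCLM q * toCLM q = toCLM q :=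
    ContinuousLinearMap.ext fun z => hproj.map_id _ (hproj.map_mem z)
  have hBi : B * toCLM i = 0 := ContinuousLinearMap.ext hiN
  have hone : (1 - toCLM q) * (B * toCLM F) = 1 - toCLM q :=
    one_sub_mul_eq_one_sub_of_isProj hproj fun x => by
      rw [LinearMap.mem_ker, map_sub, sub_eq_zero]
      exact congr($hB (toCLM F x)).symm
  have hleft : F * (1 - q) + i ∈ leftInvertible A E := by
    rw [mem_leftInvertible_iff]
    simp only [map_add, map_mul, map_sub, map_one]
    refine exists_left_inverse_add (b := (1 - toCLM q) * B) (l := toCLM l) (q := toCLM q)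
      ?_ ?_ ?_ ?_
    · rw [← mul_assoc, mul_assoc _ B, hone, mul_sub, mul_one, sub_mul, hqq, one_mul, sub_self,
        sub_zero]
    · rw [mul_assoc, hBi, mul_zero]
    · rw [mul_assoc, sub_mul, one_mul, hqq, sub_self, mul_zero]
    · rw [← map_mul, hli]
  refine ⟨_, hleft, F * q - i, sub_mem (mul_mem_finiteRank F hq) hi, ?_⟩
  simp only [mul_sub, mul_one]
  abel

theorem lowerPlusPrime_subset [CompleteSpace E] :
    lowerPlusPrime A E ⊆ rightInvertible A E + (finiteRank A E : Set (adjointable A E)) := by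
  rintro F ⟨-, M₁, N₁, M₂, N₂, hdec, hfg, hprec⟩
  obtain ⟨q, hq, i, -, l, hl, hproj, hiN, hli, hql⟩ :=
    hprec.exists_factorization hdec.closed_N₂ hfg
  obtain ⟨B, hB, rfl, rfl⟩ := hdec.exists_outer_inverse
  have hone : (1 - toCLM q) * (toCLM F * B) = 1 - toCLM q :=
    one_sub_mul_eq_one_sub_of_isProj hproj fun x => by
      rw [LinearMap.mem_ker, map_sub, sub_eq_zero]
      exact congr($hB x).symm
  have hBFi : B * toCLM F * toCLM i = 0 := ContinuousLinearMap.ext hiN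
  have hright : (1 - q) * F + l ∈ rightInvertible A E := by
    rw [mem_rightInvertible_iff]
    simp only [map_add, map_mul, map_sub, map_one]
    refine exists_right_inverse_add (b := B) (i := toCLM i) (q := toCLM q) ?_ ?_ ?_ ?_
    · rw [mul_assoc, hone]
    · rw [← hone, mul_assoc, mul_assoc, mul_assoc, ← mul_assoc B, hBFi, mul_zero, mul_zero]
    · rw [← map_mul, hli]
    · rw [← map_mul, hql]
  refine ⟨_, hright, q * F - l, sub_mem (finiteRank_mul_mem F hq) hl, ?_⟩
  simp only [sub_mul, one_mul]
  abel

theorem one_sub_mul_eq_of_mul_one_sub_eq {R : Type*} [Ring R] {p t : R}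
    (h : p * (1 - t) = 1 - t) : (1 - p) * t = 1 - p := by
  calc (1 - p) * t = 1 - p + (p * (1 - t) - (1 - t)) := by noncomm_ring
    _ = 1 - p := by rw [h, sub_self, add_zero]

theorem fg_ker_of_one_sub_mul_eq {R X : Type*} [Ring R] [NormedAddCommGroup X] [Module R X]
    {p t : X →L[R] X} (hp : IsIdempotentElem p) (hpt : (1 - p) * t = 1 - p) (ht : t.range.FG) :
    p.ker.FG := by
  have hker : p.ker = t.range.map (1 - p).toLinearMap := by
    rw [LinearMap.IsIdempotentElem.ker_eq_range_one_sub
      (ContinuousLinearMap.IsIdempotentElem.toLinearMap hp), ← LinearMap.range_comp]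
    exact congr((ContinuousLinearMap.toLinearMap $hpt).range).symm
  exact hker ▸ ht.map _

theorem mem_upperMinusPrime_of_mul_one_sub_eq {F D T : adjointable A E}
    (hD : D ∈ leftInvertible A E) (hT : IsIdempotentElem T) (hfg : (toCLM T).range.FG)
    (h : F * (1 - T) = D * (1 - T)) : F ∈ upperMinusPrime A E := by
  obtain ⟨J, hJ⟩ := mem_leftInvertible_iff.mp hD
  have hTT : IsIdempotentElem (toCLM T) := hT.map toCLM
  have hFT : toCLM F * (1 - toCLM T) = toCLM D * (1 - toCLM T) := congr(toCLM $h)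
  let B := (1 - toCLM T) * J
  let P := B * toCLM F
  have hPT : P * (1 - toCLM T) = 1 - toCLM T := by
    calc P * (1 - toCLM T) = (1 - toCLM T) * (J * toCLM D) * (1 - toCLM T) := by
          simp only [P, B, mul_assoc, hFT]
      _ = 1 - toCLM T := by rw [hJ, mul_one, hTT.one_sub.eq]
  have hB : B * toCLM F * B = B := by
    rw [← mul_assoc]
    exact congr($hPT * J)
  have hP : IsIdempotentElem P := by
    rw [IsIdempotentElem, ← mul_assoc]
    exact congr($hB * toCLM F)
  have hPT' : (1 - P) * toCLM T = 1 - P := one_sub_mul_eq_of_mul_one_sub_eq hPT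
  have hdec := isDecomposition_of_outer_inverse hB
  have hker : P.ker.FG := fg_ker_of_one_sub_mul_eq hP hPT' hfg
  have hprec : Preceq P.ker B.ker := by
    have hleft : (1 - P) * J * (toCLM D * toCLM T) = 1 - P := by
      rw [mul_assoc, ← mul_assoc J, hJ, one_mul, hPT']
    have hzero : B * (toCLM D * toCLM T) = 0 := by
      rw [mul_assoc, ← mul_assoc J, hJ, one_mul, hTT.one_sub_mul_self]
    refine preceq_of_hasLeftInverse (f := (toCLM D * toCLM T).comp P.ker.subtypeL)
      ⟨((1 - P) * J).codRestrict P.ker fun z => congr($hP.mul_one_sub_self (J z)),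
        fun z => Subtype.ext ?_⟩ fun z => congr($hzero z)
    calc ((1 - P) * J * (toCLM D * toCLM T)) z = z - P z := congr($hleft z)
      _ = z := by rw [show P z = 0 from z.2, sub_zero]
  exact ⟨⟨_, _, _, _, hdec, hker⟩, _, _, _, _, hdec, hker, hprec⟩

theorem mem_lowerPlusPrime_of_one_sub_mul_eq {F D T : adjointable A E}
    (hD : D ∈ rightInvertible A E) (hT : IsIdempotentElem T) (hfg : (toCLM T).range.FG)
    (h : (1 - T) * F = (1 - T) * D) : F ∈ lowerPlusPrime A E := by
  obtain ⟨R, hR⟩ := mem_rightInvertible_iff.mp hD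
  have hTT : IsIdempotentElem (toCLM T) := hT.map toCLM
  have hTF : (1 - toCLM T) * toCLM F = (1 - toCLM T) * toCLM D := congr(toCLM $h)
  let B := R * (1 - toCLM T)
  have hDB : toCLM D * B = 1 - toCLM T := by rw [← mul_assoc, hR, one_mul]
  have hBF : B * toCLM F = B * toCLM D := by rw [mul_assoc, hTF, ← mul_assoc]
  have hB : B * toCLM F * B = B := by
    rw [hBF, mul_assoc, hDB, mul_assoc, hTT.one_sub.eq]
  have hdec := isDecomposition_of_outer_inverse hB
  have hker : B.ker = (toCLM T).range := by
    rw [LinearMap.IsIdempotentElem.range_eq_ker_one_sub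
      (ContinuousLinearMap.IsIdempotentElem.toLinearMap hTT)]
    refine le_antisymm (fun z hz => ?_) (LinearMap.ker_le_ker_comp _ _)
    exact congr($hDB z).symm.trans ((congrArg (toCLM D) hz).trans (map_zero _))
  have hprec : Preceq B.ker (B * toCLM F).ker := by
    have hBT : B * (toCLM T * toCLM D) = 0 := by
      rw [← mul_assoc, mul_assoc R, hTT.one_sub_mul_self, mul_zero, zero_mul]
    have hleft : toCLM T * toCLM D * R = 1 - (1 - toCLM T) := by
      rw [mul_assoc, hR, mul_one, sub_sub_cancel]
    have hright : B * toCLM F * R = B := by rw [hBF, mul_assoc, hR, mul_one]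
    refine preceq_of_hasLeftInverse (f := R.comp B.ker.subtypeL)
      ⟨(toCLM T * toCLM D).codRestrict B.ker fun z => congr($hBT z), fun z => Subtype.ext ?_⟩
      fun z => congr($hright z).trans z.2
    calc (toCLM T * toCLM D * R) z = z - toCLM D (B z) := by rw [hleft, ← hDB]; rfl
      _ = z := by rw [show B z = 0 from z.2, map_zero, sub_zero]
  rw [← hker] at hfg
  exact ⟨⟨_, _, _, _, hdec, hfg⟩, _, _, _, _, hdec, hfg, hprec⟩

variable (A E) in
/-- Finite rank operators are approximated by their compressions to the finitely generated ranges
of adjointable idempotents. -/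
def HasFGIdempotentApproximation : Prop :=
  ∀ C ∈ finiteRank A E, ∀ ε > 0, ∃ T : adjointable A E, IsIdempotentElem T ∧
    (toCLM T).range.FG ∧ ‖C - C * T‖ < ε ∧ ‖C - T * C‖ < ε

theorem upperMinusPrime_eq [CompleteSpace E] (h : HasFGIdempotentApproximation A E) :
    upperMinusPrime A E = leftInvertible A E + (compactOperators A E : Set (adjointable A E)) := by
  have hcl : leftInvertible A E + (compactOperators A E : Set (adjointable A E)) =
      leftInvertible A E + (finiteRank A E : Set (adjointable A E)) :=
    isOpen_leftInvertible.add_closure _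
  rw [hcl]
  refine upperMinusPrime_subset.antisymm ?_
  rintro _ ⟨D, hD, C, hC, rfl⟩
  obtain ⟨ε, hε, hball⟩ := Metric.isOpen_iff.mp isOpen_leftInvertible D hD
  obtain ⟨T, hT, hfg, hlt, -⟩ := h C hC ε hε
  refine mem_upperMinusPrime_of_mul_one_sub_eq (D := D + (C - C * T))
    (hball (by rwa [Metric.mem_ball, dist_eq_norm, add_sub_cancel_left])) hT hfg ?_
  have : C * T * (1 - T) = 0 := by rw [mul_assoc, hT.mul_one_sub_self, mul_zero]
  rw [add_mul, add_mul, sub_mul, this, sub_zero]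

theorem lowerPlusPrime_eq [CompleteSpace E] (h : HasFGIdempotentApproximation A E) :
    lowerPlusPrime A E = rightInvertible A E + (compactOperators A E : Set (adjointable A E)) := by
  have hcl : rightInvertible A E + (compactOperators A E : Set (adjointable A E)) =
      rightInvertible A E + (finiteRank A E : Set (adjointable A E)) :=
    isOpen_rightInvertible.add_closure _
  rw [hcl]
  refine lowerPlusPrime_subset.antisymm ?_
  rintro _ ⟨D, hD, C, hC, rfl⟩
  obtain ⟨ε, hε, hball⟩ := Metric.isOpen_iff.mp isOpen_rightInvertible D hD
  obtain ⟨T, hT, hfg, -, hlt⟩ := h C hC ε hε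
  refine mem_lowerPlusPrime_of_one_sub_mul_eq (D := D + (C - T * C))
    (hball (by rwa [Metric.mem_ball, dist_eq_norm, add_sub_cancel_left])) hT hfg ?_
  have : (1 - T) * (T * C) = 0 := by rw [← mul_assoc, hT.one_sub_mul_self, zero_mul]
  rw [mul_add, mul_add, mul_sub, this, sub_zero]

/-! ### Orthonormal bases -/

section OrthonormalBasis

variable {ι : Type*}

theorem continuous_rankOne_left (y : E) : Continuous fun x => (rankOne x y : adjointable A E) := by
  let φ : E →+ adjointable A E := AddMonoidHom.mk' (fun x => rankOne x y) fun x x' =>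
    Subtype.ext <| ContinuousLinearMap.ext fun z => smul_add ⟪y, z⟫_A x x'
  exact AddMonoidHomClass.continuous_of_bound φ ‖y‖ fun x => norm_rankOne_le x y

theorem continuous_rankOne_right (x : E) : Continuous fun y => (rankOne x y : adjointable A E) := by
  let φ : E →+ adjointable A E := AddMonoidHom.mk' (fun y => rankOne x y) fun y y' =>
    Subtype.ext <| ContinuousLinearMap.ext fun z =>
      (congrArg (· • x) CStarModule.inner_add_left).trans (add_smul ⟪y, z⟫_A ⟪y', z⟫_A x)
  exact AddMonoidHomClass.continuous_of_bound φ ‖x‖ fun y =>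
    (norm_rankOne_le x y).trans_eq (mul_comm _ _)

theorem tendsto_mul_of_mem_finiteRank {α : Type*} {l : Filter α} {S : α → adjointable A E}
    (hS : ∀ x : E, Tendsto (fun a => (S a).1 x) l (𝓝 x)) {C : adjointable A E}
    (hC : C ∈ finiteRank A E) : Tendsto (fun a => S a * C) l (𝓝 C) := by
  induction hC using Submodule.span_induction with
  | mem C hC =>
    obtain ⟨⟨x, y⟩, rfl⟩ := hC
    simp only [mul_rankOne]
    exact (continuous_rankOne_left y).continuousAt.tendsto.comp (hS x)
  | zero => simpa only [mul_zero] using tendsto_const_nhds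
  | add C C' _ _ h h' => simpa only [mul_add] using h.add h'
  | smul c C _ h => simpa only [mul_smul_comm] using h.const_smul c

theorem tendsto_finiteRank_mul {α : Type*} {l : Filter α} {S : α → adjointable A E}
    (hsymm : ∀ a, ∀ x y : E, ⟪(S a).1 x, y⟫_A = ⟪x, (S a).1 y⟫_A)
    (hS : ∀ x : E, Tendsto (fun a => (S a).1 x) l (𝓝 x)) {C : adjointable A E}
    (hC : C ∈ finiteRank A E) : Tendsto (fun a => C * S a) l (𝓝 C) := by
  induction hC using Submodule.span_induction with
  | mem C hC =>
    obtain ⟨⟨x, y⟩, rfl⟩ := hC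
    simp only [rankOne_mul (hsymm _)]
    exact (continuous_rankOne_right x).continuousAt.tendsto.comp (hS y)
  | zero => simpa only [zero_mul] using tendsto_const_nhds
  | add C C' _ _ h h' => simpa only [add_mul] using h.add h'
  | smul c C _ h => simpa only [smul_mul_assoc] using h.const_smul c

variable (A) in
/-- An orthonormal basis of a Hilbert module: an orthonormal family of vectors satisfying Parseval's
identity, with norm convergence in `A`. -/
structure IsOrthonormalBasis (e : ι → E) : Prop where
  inner_self (i : ι) : ⟪e i, e i⟫_A = 1
  inner_eq_zero : Pairwise fun i j => ⟪e i, e j⟫_A = 0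
  hasSum_inner_self (x : E) : HasSum (fun i => ⟪e i, x⟫_A * star ⟪e i, x⟫_A) ⟪x, x⟫_A

namespace IsOrthonormalBasis

variable {e : ι → E}

theorem frameOperator_apply_self (he : IsOrthonormalBasis A e) {s : Finset ι} {i : ι} (hi : i ∈ s) :
    (frameOperator A s e).1 (e i) = e i := by
  rw [frameOperator_apply, Finset.sum_eq_single_of_mem i hi fun j _ hj => ?_]
  · rw [he.inner_self, one_smul]
  · rw [he.inner_eq_zero hj, zero_smul]

theorem isIdempotentElem_frameOperator (he : IsOrthonormalBasis A e) (s : Finset ι) :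
    IsIdempotentElem (frameOperator A s e) := by
  rw [IsIdempotentElem]
  nth_rw 2 [frameOperator]
  simp only [Finset.mul_sum, mul_rankOne]
  exact Finset.sum_congr rfl fun i hi => by rw [he.frameOperator_apply_self hi]

theorem norm_sq_frameOperator_sub (he : IsOrthonormalBasis A e) (s : Finset ι) (x : E) :
    ‖(frameOperator A s e).1 x - x‖ ^ 2 =
      ‖⟪x, x⟫_A - ∑ i ∈ s, ⟪e i, x⟫_A * star ⟪e i, x⟫_A‖ := by
  have hidem : (frameOperator A s e).1 ((frameOperator A s e).1 x) = (frameOperator A s e).1 x :=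
    congr(($(he.isIdempotentElem_frameOperator s)).1 x)
  rw [CStarModule.norm_sq_eq A, CStarModule.inner_sub_left, CStarModule.inner_sub_right,
    CStarModule.inner_sub_right, inner_frameOperator_left, inner_frameOperator_left, hidem,
    inner_frameOperator_self, sub_self, zero_sub, neg_sub]

theorem tendsto_frameOperator (he : IsOrthonormalBasis A e) (x : E) :
    Tendsto (fun s : Finset ι => (frameOperator A s e).1 x) atTop (𝓝 x) := by
  rw [tendsto_iff_norm_sub_tendsto_zero]
  have hsq : Tendsto (fun s : Finset ι => ‖(frameOperator A s e).1 x - x‖ ^ 2) atTop (𝓝 0) := by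
    simp only [he.norm_sq_frameOperator_sub]
    simpa only [SummationFilter.unconditional_filter, sub_self, norm_zero] using
      (Tendsto.const_sub ⟪x, x⟫_A (he.hasSum_inner_self x)).norm
  simpa using hsq.sqrt

theorem fg_range_frameOperator (he : IsOrthonormalBasis A e) (s : Finset ι) :
    (toCLM (frameOperator A s e)).range.FG := by
  have hrange : (toCLM (frameOperator A s e)).range = Submodule.span A (e '' s) := by
    refine le_antisymm ?_ (Submodule.span_le.mpr ?_)
    · rintro _ ⟨x, rfl⟩
      change (frameOperator A s e).1 x ∈ _
      rw [frameOperator_apply]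
      exact sum_mem fun i hi => Submodule.smul_mem _ _
        (Submodule.subset_span (Set.mem_image_of_mem e hi))
    · rintro _ ⟨i, hi, rfl⟩
      exact ⟨e i, he.frameOperator_apply_self hi⟩
  exact hrange ▸ Submodule.fg_span (s.finite_toSet.image e)

theorem hasFGIdempotentApproximation (he : IsOrthonormalBasis A e) :
    HasFGIdempotentApproximation A E := by
  intro C hC ε hε
  have hright := tendsto_finiteRank_mul
    (fun s => inner_frameOperator_left s e) he.tendsto_frameOperator hC
  have hleft := tendsto_mul_of_mem_finiteRank he.tendsto_frameOperator hC
  obtain ⟨s, hs, hs'⟩ := ((Metric.tendsto_nhds.mp hright ε hε).and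
    (Metric.tendsto_nhds.mp hleft ε hε)).exists
  rw [dist_comm, dist_eq_norm] at hs hs'
  exact ⟨frameOperator A s e, he.isIdempotentElem_frameOperator s, he.fg_range_frameOperator s,
    hs, hs'⟩

end IsOrthonormalBasis

end OrthonormalBasis

end Module

/-! ### The standard module -/

namespace StdModule

variable {A : Type*} [CStarAlgebra A] [PartialOrder A] [StarOrderedRing A]

/-- The restriction of a sequence to a finite set of indices, extended by zero to an element of the
standard module. -/
def truncate (s : Finset ℕ) : (ℕ → A) →ₗ[A] StdModule A where
  toFun f := ⟨fun i => if i ∈ s then f i else 0,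
    summable_of_ne_finset_zero (s := s) fun i hi => by simp [hi]⟩
  map_add' f g := ext_coord fun i => by
    change (if i ∈ s then f i + g i else 0) = (if i ∈ s then f i else 0) + if i ∈ s then g i else 0
    split_ifs <;> simp
  map_smul' a f := ext_coord fun i => (mul_ite_zero (i ∈ s) a (f i)).symm

theorem coord_truncate (s : Finset ℕ) (f : ℕ → A) (i : ℕ) :
    (truncate s f).coord i = if i ∈ s then f i else 0 := rfl

theorem norm_sq_eq_tsum (x : StdModule A) :
    ‖x‖ ^ 2 = ‖∑' i, x.coord i * star (x.coord i)‖ := by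
  rw [CStarModule.norm_sq_eq A, inner_def]

theorem norm_sq_truncate (s : Finset ℕ) (f : ℕ → A) :
    ‖truncate s f‖ ^ 2 = ‖∑ i ∈ s, f i * star (f i)‖ := by
  rw [norm_sq_eq_tsum, tsum_eq_sum (s := s) fun i hi => by simp [coord_truncate, hi]]
  congr 1
  exact Finset.sum_congr rfl fun i hi => by rw [coord_truncate, if_pos hi]

theorem continuous_norm_truncate (s : Finset ℕ) : Continuous fun f : ℕ → A => ‖truncate s f‖ := by
  have h (f : ℕ → A) : ‖truncate s f‖ = √‖∑ i ∈ s, f i * star (f i)‖ := by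
    rw [← norm_sq_truncate, Real.sqrt_sq (norm_nonneg _)]
  simp only [h]
  fun_prop

theorem norm_truncate_coord_le (s : Finset ℕ) (x : StdModule A) : ‖truncate s x.coord‖ ≤ ‖x‖ := by
  refine le_of_sq_le_sq ?_ (norm_nonneg _)
  rw [norm_sq_truncate, norm_sq_eq_tsum]
  exact CStarAlgebra.norm_le_norm_of_nonneg_of_le
    (Finset.sum_nonneg fun i _ => mul_star_self_nonneg _)
    (x.summable_self.sum_le_tsum s fun i _ => mul_star_self_nonneg _)

theorem norm_le_of_forall_norm_truncate_le {x : StdModule A} {r : ℝ}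
    (h : ∀ s, ‖truncate s x.coord‖ ≤ r) : ‖x‖ ≤ r := by
  refine le_of_sq_le_sq ?_ ((norm_nonneg _).trans (h ∅))
  rw [norm_sq_eq_tsum]
  refine le_of_tendsto' x.summable_self.hasSum.norm fun s => ?_
  rw [← norm_sq_truncate]
  gcongr
  exact h s

theorem norm_coord_le (x : StdModule A) (i : ℕ) : ‖x.coord i‖ ≤ ‖x‖ := by
  refine le_of_sq_le_sq ?_ (norm_nonneg _)
  calc ‖x.coord i‖ ^ 2 = ‖truncate {i} x.coord‖ ^ 2 := by
        rw [norm_sq_truncate, Finset.sum_singleton, CStarRing.norm_self_mul_star, sq]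
    _ ≤ ‖x‖ ^ 2 := by gcongr; exact norm_truncate_coord_le _ x

theorem lipschitzWith_coord (i : ℕ) : LipschitzWith 1 fun x : StdModule A => x.coord i :=
  LipschitzWith.mk_one fun x y => by
    rw [dist_eq_norm, dist_eq_norm]
    exact norm_coord_le (x - y) i

theorem mem_sqSummable_iff_vanishing {f : ℕ → A} :
    f ∈ sqSummable A ↔ ∀ ε > 0, ∃ s, ∀ t, Disjoint t s → ‖truncate t f‖ < ε := by
  change Summable _ ↔ _
  simp only [summable_iff_vanishing_norm, ← norm_sq_truncate]
  refine ⟨fun h ε hε => (h (ε ^ 2) (by positivity)).imp fun s hs t ht =>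
    lt_of_pow_lt_pow_left₀ 2 hε.le (hs t ht), fun h ε hε => (h √ε (by positivity)).imp
    fun s hs t ht => (Real.lt_sqrt (norm_nonneg _)).mp (hs t ht)⟩

theorem mem_sqSummable_of_forall_exists_approx {f : ℕ → A}
    (h : ∀ ε > 0, ∃ x : StdModule A, ∀ s, ‖truncate s (x.coord - f)‖ ≤ ε) :
    f ∈ sqSummable A := by
  refine mem_sqSummable_iff_vanishing.mpr fun ε hε => ?_
  obtain ⟨x, hx⟩ := h (ε / 2) (half_pos hε)
  obtain ⟨s, hs⟩ := mem_sqSummable_iff_vanishing.mp x.2 (ε / 2) (half_pos hε)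
  refine ⟨s, fun t ht => ?_⟩
  calc ‖truncate t f‖ = ‖truncate t x.coord - truncate t (x.coord - f)‖ := by
        rw [← map_sub, sub_sub_cancel]
    _ ≤ ‖truncate t x.coord‖ + ‖truncate t (x.coord - f)‖ := norm_sub_le _ _
    _ < ε / 2 + ε / 2 := add_lt_add_of_lt_of_le (hs t ht) (hx t)
    _ = ε := add_halves ε

theorem exists_forall_norm_truncate_sub_le {u : ℕ → StdModule A} (hu : CauchySeq u) {f : ℕ → A}
    (hf : Tendsto (fun k => (u k).coord) atTop (𝓝 f)) {ε : ℝ} (hε : 0 < ε) :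
    ∃ N, ∀ k ≥ N, ∀ s, ‖truncate s ((u k).coord - f)‖ ≤ ε := by
  obtain ⟨N, hN⟩ := Metric.cauchySeq_iff.mp hu ε hε
  refine ⟨N, fun k hk s => ?_⟩
  refine le_of_tendsto (((continuous_norm_truncate s).tendsto _).comp (hf.const_sub _)) ?_
  filter_upwards [eventually_ge_atTop N] with l hl
  calc ‖truncate s ((u k).coord - (u l).coord)‖ ≤ ‖u k - u l‖ :=
        norm_truncate_coord_le s (u k - u l)
    _ ≤ ε := (dist_eq_norm (u k) (u l)).symm.trans_le (hN k hk l hl).le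

instance : CompleteSpace (StdModule A) := by
  refine Metric.complete_of_cauchySeq_tendsto fun u hu => ?_
  have hcoord (i : ℕ) : CauchySeq fun k => (u k).coord i :=
    (lipschitzWith_coord i).uniformContinuous.comp_cauchySeq hu
  choose f hf using fun i => cauchySeq_tendsto_of_complete (hcoord i)
  have happrox {ε : ℝ} (hε : 0 < ε) :=
    exists_forall_norm_truncate_sub_le hu (tendsto_pi_nhds.mpr hf) hε
  have hmem : f ∈ sqSummable A := mem_sqSummable_of_forall_exists_approx fun ε hε =>
    (happrox hε).elim fun N hN => ⟨u N, hN N le_rfl⟩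
  let x : StdModule A := ⟨f, hmem⟩
  refine ⟨x, Metric.tendsto_atTop'.mpr fun ε hε => ?_⟩
  obtain ⟨N, hN⟩ := happrox (half_pos hε)
  refine ⟨N, fun k hk => ?_⟩
  rw [dist_eq_norm]
  exact (norm_le_of_forall_norm_truncate_le (x := u k - x) (hN k hk.le)).trans_lt (half_lt_self hε)

/-- The standard basis of `ℓ²(A)`. -/
def basisVec (i : ℕ) : StdModule A := truncate {i} 1

theorem coord_basisVec (i j : ℕ) : (basisVec i : StdModule A).coord j = if j = i then 1 else 0 := by
  simp [basisVec, coord_truncate]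

theorem inner_basisVec (i : ℕ) (x : StdModule A) : ⟪basisVec i, x⟫_A = x.coord i := by
  rw [inner_def, tsum_eq_single i fun j hj => by simp [coord_basisVec, hj]]
  simp [coord_basisVec]

variable (A) in
theorem isOrthonormalBasis_basisVec :
    IsOrthonormalBasis A (basisVec : ℕ → StdModule A) where
  inner_self i := by rw [inner_basisVec, coord_basisVec, if_pos rfl]
  inner_eq_zero i j hij := (inner_basisVec i _).trans <| by rw [coord_basisVec, if_neg hij]
  hasSum_inner_self x := by
    simp only [inner_basisVec]
    exact x.summable_self.hasSum

end StdModule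

end HilbertModule

theorem lemma5p9_general {A E : Type*} [CStarAlgebra A] [PartialOrder A] [StarOrderedRing A]
    [NormedAddCommGroup E] [NormedSpace ℂ E] [Module A E] [CStarModule A E] [CompleteSpace E]
    (h : HilbertModule.HasFGIdempotentApproximation A E) :
    IsOpen (HilbertModule.upperMinusPrime A E) ∧ IsOpen (HilbertModule.lowerPlusPrime A E) ∧
    (∀ F ∈ HilbertModule.upperMinusPrime A E, ∀ K ∈ HilbertModule.compactOperators A E,
      F + K ∈ HilbertModule.upperMinusPrime A E) ∧
    (∀ F ∈ HilbertModule.lowerPlusPrime A E, ∀ K ∈ HilbertModule.compactOperators A E,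
      F + K ∈ HilbertModule.lowerPlusPrime A E) := by
  rw [HilbertModule.upperMinusPrime_eq h, HilbertModule.lowerPlusPrime_eq h]
  refine ⟨HilbertModule.isOpen_leftInvertible.add_right,
    HilbertModule.isOpen_rightInvertible.add_right, ?_, ?_⟩
  all_goals
    rintro _ ⟨D, hD, K', hK', rfl⟩ K hK
    exact ⟨D, hD, K' + K, add_mem hK' hK, (add_assoc D K' K).symm⟩

theorem lemma5p9 {A : Type*} [CStarAlgebra A] [PartialOrder A] [StarOrderedRing A] :
    IsOpen (HilbertModule.upperMinusPrime A (HilbertModule.StdModule A)) ∧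
    IsOpen (HilbertModule.lowerPlusPrime A (HilbertModule.StdModule A)) ∧
    (∀ F ∈ HilbertModule.upperMinusPrime A (HilbertModule.StdModule A),
      ∀ K ∈ HilbertModule.compactOperators A (HilbertModule.StdModule A),
        F + K ∈ HilbertModule.upperMinusPrime A (HilbertModule.StdModule A)) ∧
    (∀ F ∈ HilbertModule.lowerPlusPrime A (HilbertModule.StdModule A),
      ∀ K ∈ HilbertModule.compactOperators A (HilbertModule.StdModule A),
        F + K ∈ HilbertModule.lowerPlusPrime A (HilbertModule.StdModule A)) :=
  lemma5p9_general
    (HilbertModule.StdModule.isOrthonormalBasis_basisVec A).hasFGIdempotentApproximation
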